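/- Let $G=(V,E)$ be a finite simple graph with adjacency matrix $\Gamma_G=(a_{vw})_{v,w\in V}$. Its graph state is $$|G\rangle=\prod_{\{v,w\}\in E}\mathrm{CZ}^{\{v,w\}}\,|+\rangle^{\otimes V}\in(\mathbb C^2)^{\otimes V},\qquad |+\rangle=\tfrac1{\sqrt2}(|0\rangle+|1\rangle),$$ where $\mathrm{CZ}^{\{v,w\}}$ multiplies the computational basis vector $|x\rangle$, $x\in\{0,1\}^V$, by $(-1)^{x_vx_w}$. For a state $|\psi\rangle$ and $A\subseteq V$ with complement $A'=V\setminus A$, the entropy of entanglement is $S_A(|\psi\rangle)=-\mathrm{Tr}(\rho_A\log_2\rho_A)$, where $\rho_A=\mathrm{tr}_{A'}|\psi\rangle\langle\psi|$. Write $v\sim w$ if $v,w$ lie in the same connected component of $G$ and $a_{vu_1}a_{wu_2}=a_{vu_2}a_{wu_1}$ for all vertices $u_1,u_2\notin\{v,w\}$. This is an equivalence relation; its set of classes $\hat V$ is the foliage partition of $G$. A part $P\in\hat V$ is of type *singleton* if $|P|=1$. If $|P|\ge 2$, it is of type * *clique* if $P$ induces a complete graph and any two $v,w\in P$ have the same neighbors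 outside $\{v,w\}$; * *independent* if $P$ induces a graph without edges and all $v\in P$ have the same neighborhood; * *star* if $P$ induces a star graph and only its center has neighbors outside $P$. Every part has exactly one of these types, except that a connected component consisting of a single edge is both a clique and a star; such a part is counted as being of type clique. The graph $G$ is in *normal form* if no part is of type star. The foliage graph $\hat G$ is the simple graph on $\hat V$ in which distinct parts $P\ne Q$ are adjacent if and only if some vertex of $P$ is adjacent in $G$ to some vertex of $Q$. Let $D_T$ be the diagonal matrix indexed by $\hat V$ whose entry at $P$ is $1$ if $P$ is of type clique and $0$ otherwise, and let $E_{T,\hat G}=\Gamma_{\hat G}+D_T$, regarded as a matrix over $\mathbb F_2$. **Proposition.** Let $G$ be in normal form. For every $A\subseteq V$ with complement $A'$, put $$\hat A=\{P\in\hat V: P\cap A\ne\emptyset\},\qquad \hat A'=\{P\in\hat V: P\cap A'\neq\emptyset\}.$$ Then $$S_A(|G\rangle)=\operatorname{rank}_{\mathbb F_2}E_{T,\hat G}^{\hat A\,\hat A'},$$ where $E_{T,\hat G}^{\hat A\,\hat A'}$ is the submatrix of $E_{T,\hat G}$ with rows indexed by $\hat A$ and columns indexed by $\hat A'$. -/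

import Mathlib

noncomputable section

open scoped Classical

/-! ### The foliage partition of a graph -/

namespace SimpleGraph

variable {V : Type*} (G : SimpleGraph V)

/-- The relation `v ∼ w`: the two vertices lie in the same connected component, and
`a_{v,u₁} a_{w,u₂} = a_{v,u₂} a_{w,u₁}` for all `u₁, u₂` other than `v` and `w`, where `a` is the
adjacency matrix. -/
def FoliageRel (v w : V) : Prop :=
  G.Reachable v w ∧ ∀ u₁ u₂ : V, u₁ ≠ v → u₁ ≠ w → u₂ ≠ v → u₂ ≠ w →
    G.adjMatrix (ZMod 2) v u₁ * G.adjMatrix (ZMod 2) w u₂ =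
      G.adjMatrix (ZMod 2) v u₂ * G.adjMatrix (ZMod 2) w u₁

theorem foliageRel_iff (v w : V) : G.FoliageRel v w ↔
    G.Reachable v w ∧ ∀ u₁ u₂ : V, u₁ ≠ v → u₁ ≠ w → u₂ ≠ v → u₂ ≠ w →
      ((G.Adj v u₁ ∧ G.Adj w u₂) ↔ (G.Adj v u₂ ∧ G.Adj w u₁)) := by
  unfold FoliageRel
  refine and_congr_right fun _ => forall_congr' fun u₁ => forall_congr' fun u₂ =>
    forall_congr' fun _ => forall_congr' fun _ => forall_congr' fun _ => forall_congr' fun _ => ?_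
  simp only [adjMatrix_apply]
  split_ifs <;> simp_all

theorem exists_adj_of_reachable_ne {v w : V} (h : G.Reachable v w) (hne : v ≠ w) :
    ∃ u, G.Adj v u := by
  obtain ⟨p⟩ := h
  cases p with
  | nil => exact absurd rfl hne
  | cons h _ => exact ⟨_, h⟩

theorem foliageRel_equivalence : Equivalence G.FoliageRel where
  refl v := ⟨Reachable.refl v, fun u₁ u₂ _ _ _ _ => mul_comm _ _⟩
  symm {v w} h := ⟨h.1.symm, fun u₁ u₂ h₁ h₂ h₃ h₄ => by
    rw [mul_comm, ← h.2 u₁ u₂ h₂ h₁ h₄ h₃, mul_comm]⟩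
  trans {v w z} h₁ h₂ := by
    by_cases hvw : v = w
    · subst hvw; exact h₂
    by_cases hwz : w = z
    · subst hwz; exact h₁
    by_cases hvz : v = z
    · subst hvz
      exact ⟨Reachable.refl v, fun u₁ u₂ _ _ _ _ => mul_comm _ _⟩
    rw [foliageRel_iff] at *
    obtain ⟨c₁, r₁⟩ := h₁
    obtain ⟨c₂, r₂⟩ := h₂
    obtain ⟨x, hx⟩ := G.exists_adj_of_reachable_ne c₂ hwz
    have s : ∀ a b, G.Adj a b → G.Adj b a := fun _ _ h => h.symm
    have key : ∀ u₁ u₂ : V, u₁ ≠ v → u₁ ≠ z → u₂ ≠ v → u₂ ≠ z →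
        G.Adj v u₁ → G.Adj z u₂ → G.Adj v u₂ ∧ G.Adj z u₁ := by
      intro u₁ u₂ a₁ a₂ a₃ a₄ h h'
      have e₁ := r₁ u₁ u₂
      have e₂ := r₂ u₁ u₂
      have e₃ := r₁ u₁ z
      have e₄ := r₂ v u₂
      have e₅ := r₁ u₂ z
      have e₆ := r₂ v u₁
      have e₇ := r₂ x u₂
      have e₈ := r₁ x u₁
      clear r₁ r₂ c₁ c₂ s
      have q₁ := G.adj_comm z v
      have q₂ := G.adj_comm z w
      have q₃ := G.adj_comm w v
      by_cases d₁ : u₁ = w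
      · subst d₁
        by_cases d₂ : u₂ = u₁
        · subst d₂; exact ⟨h, h'⟩
        · grind
      by_cases d₂ : u₂ = w
      · subst d₂; grind
      by_cases d₃ : x = v
      · subst d₃; grind
      by_cases d₄ : x = z
      · subst d₄; grind
      have hxw : x ≠ w := hx.ne'
      grind
    exact ⟨c₁.trans c₂, fun u₁ u₂ a₁ a₂ a₃ a₄ =>
      ⟨fun h => key u₁ u₂ a₁ a₂ a₃ a₄ h.1 h.2, fun h => key u₂ u₁ a₃ a₄ a₁ a₂ h.1 h.2⟩⟩

def foliageSetoid : Setoid V := ⟨G.FoliageRel, G.foliageRel_equivalence⟩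

/-- The foliage partition `V̂`: its elements are the equivalence classes of `∼`. -/
def FoliagePartition : Type _ := Quotient G.foliageSetoid

/-- The part of the foliage partition that contains `v`. -/
def foliageClass (v : V) : G.FoliagePartition := Quotient.mk G.foliageSetoid v

instance [Fintype V] : Fintype G.FoliagePartition :=
  inferInstanceAs (Fintype (Quotient G.foliageSetoid))

/-- The set of vertices that belong to a given part. -/
def foliagePart (P : G.FoliagePartition) : Set V := {v | G.foliageClass v = P}

theorem foliageRel_of_mem {P : G.FoliagePartition} {v w : V}
    (hv : v ∈ G.foliagePart P) (hw : w ∈ G.foliagePart P) : G.FoliageRel v w :=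
  Quotient.exact (hv.trans hw.symm : G.foliageClass v = G.foliageClass w)

/-! ### Types of vertex sets -/

/-- `W` consists of exactly one vertex. -/
def IsSingletonPart (W : Set V) : Prop := ∃ v, W = {v}

/-- `W` has at least two elements, induces a star graph, and is connected to the rest of the graph
only by the center of this star. -/
def IsStarPart (W : Set V) : Prop :=
  W.Nontrivial ∧ ∃ c ∈ W,
    (∀ v ∈ W, ∀ w ∈ W, G.Adj v w ↔ v ≠ w ∧ (v = c ∨ w = c)) ∧
    ∀ v ∈ W, v ≠ c → ∀ u ∉ W, ¬ G.Adj v u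

/-- `W` has at least two elements, induces a complete graph, and any two vertices `v, w` of `W`
have the same neighborhood (apart from `v` and `w` themselves). -/
def IsCliquePart (W : Set V) : Prop :=
  W.Nontrivial ∧ (∀ v ∈ W, ∀ w ∈ W, v ≠ w → G.Adj v w) ∧
    ∀ v ∈ W, ∀ w ∈ W, G.neighborSet v \ {w} = G.neighborSet w \ {v}

/-- `W` has at least two elements, induces a graph without edges, and all vertices of `W` have the
same neighborhood. -/
def IsIndepPart (W : Set V) : Prop :=
  W.Nontrivial ∧ (∀ v ∈ W, ∀ w ∈ W, ¬ G.Adj v w) ∧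
    ∀ v ∈ W, ∀ w ∈ W, G.neighborSet v = G.neighborSet w

end SimpleGraph

inductive FoliageType
  | singleton
  | star
  | clique
  | indep

namespace SimpleGraph

variable {V : Type*} (G : SimpleGraph V)

/-- The vertex set `W` is of type `t`. -/
def HasFoliageType (W : Set V) : FoliageType → Prop
  | .singleton => IsSingletonPart W
  | .star => G.IsStarPart W
  | .clique => G.IsCliquePart W
  | .indep => G.IsIndepPart W

/-- The type function `T`. A connected component with exactly two vertices is a part that is both
a star and a clique; its type is `clique` by convention. In all other cases a part has only one
type. -/
def foliageType (P : G.FoliagePartition) : FoliageType :=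
  if IsSingletonPart (G.foliagePart P) then .singleton
  else if G.IsCliquePart (G.foliagePart P) then .clique
  else if G.IsIndepPart (G.foliagePart P) then .indep
  else .star

/-- The type function is well defined: every part is of the type that is assigned to it. -/
theorem hasFoliageType_foliageType (P : G.FoliagePartition) :
    G.HasFoliageType (G.foliagePart P) (G.foliageType P) := by
  unfold foliageType
  split_ifs with h₁ h₂ h₃
  · exact h₁
  · exact h₂
  · exact h₃
  change G.IsStarPart _
  have hnt : (G.foliagePart P).Nontrivial := by
    obtain ⟨v, hv⟩ := Quotient.exists_rep P
    by_contra hn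
    rw [Set.not_nontrivial_iff] at hn
    exact h₁ ⟨v, hn.eq_singleton_of_mem hv⟩
  have R : ∀ v ∈ G.foliagePart P, ∀ w ∈ G.foliagePart P, _ := fun v hv w hw =>
    (G.foliageRel_iff v w).1 (G.foliageRel_of_mem hv hw)
  have N : ∀ v ∈ G.foliagePart P, ∃ u, G.Adj v u := by
    intro v hv
    obtain ⟨w, hw, hne⟩ := hnt.exists_ne v
    exact G.exists_adj_of_reachable_ne (R v hv w hw).1 hne.symm
  have s : ∀ a b, G.Adj a b → G.Adj b a := fun _ _ h => h.symm
  have I : ∀ a, ¬ G.Adj a a := fun a => G.loopless.irrefl a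
  set W := G.foliagePart P with hW
  -- non-adjacent vertices of a part have the same neighbors
  have F : ∀ v ∈ W, ∀ w ∈ W, ¬ G.Adj v w → ∀ u, G.Adj v u → G.Adj w u := by
    intro v hv w hw hn u hu
    obtain ⟨y, hy⟩ := N w hw
    have hyv : y ≠ v := by rintro rfl; exact hn (s _ _ hy)
    have huw : u ≠ w := by rintro rfl; exact hn hu
    exact (((R v hv w hw).2 u y hu.ne' huw hyv hy.ne').1 ⟨hu, hy⟩).2
  -- adjacent vertices of a part are twins, or one of them is a leaf
  by_cases hleaf : ∃ l ∈ W, ∃ c ∈ W, G.Adj l c ∧ ∀ u, G.Adj l u → u = c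
  · obtain ⟨l, hl, c, hc, hlc, hu⟩ := hleaf
    have L : ∀ v ∈ W, v ≠ c → ∀ u, G.Adj v u ↔ u = c := by
      intro v hv hvc u
      have h := F v hv l hl
      have h' := F l hl v hv
      by_cases hvl : v = l
      · subst hvl; exact ⟨hu u, fun h => h ▸ hlc⟩
      · have hn : ¬ G.Adj l v := fun h => hvc (hu v h)
        exact ⟨fun k => hu u (h (fun q => hn (s _ _ q)) u k), fun k => k ▸ h' hn c hlc⟩
    refine ⟨hnt, c, hc, ?_, ?_⟩
    · intro v hv w hw
      have h1 := L v hv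
      have h2 := L w hw
      grind
    · intro v hv hvc u huW huv
      exact huW (((L v hv hvc u).1 huv) ▸ hc)
  · exfalso
    have T : ∀ v ∈ W, ∀ w ∈ W, G.Adj v w → ∀ u, u ≠ w → G.Adj v u → G.Adj w u := by
      intro v hv w hw hvw u huw hu
      have : ∃ y, G.Adj w y ∧ y ≠ v := by
        by_contra hcon
        push Not at hcon
        exact hleaf ⟨w, hw, v, hv, s _ _ hvw, hcon⟩
      obtain ⟨y, hy, hyv⟩ := this
      exact (((R v hv w hw).2 u y hu.ne' huw hyv hy.ne').1 ⟨hu, hy⟩).2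
    by_cases hadj : ∃ x ∈ W, ∃ y ∈ W, G.Adj x y
    · obtain ⟨x, hx, y, hy, hxy⟩ := hadj
      have A : ∀ v ∈ W, v ≠ x → G.Adj v x := by
        intro v hv hvx
        by_contra hn
        have h1 := F x hx v hv (fun h => hn (s _ _ h)) y hxy
        have h2 := T y hy x hx (s _ _ hxy) v hvx (s _ _ h1)
        exact hn (s _ _ h2)
      have B : ∀ v ∈ W, ∀ w ∈ W, v ≠ w → G.Adj v w := by
        intro v hv w hw hvw
        by_cases hvx : v = x
        · subst hvx; exact s _ _ (A w hw hvw.symm)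
        by_cases hwx : w = x
        · subst hwx; exact A v hv hvw
        exact s _ _ (T x hx w hw (s _ _ (A w hw hwx)) v hvw (s _ _ (A v hv hvx)))
      refine h₂ ⟨hnt, B, fun v hv w hw => ?_⟩
      have h1 := T v hv w hw
      have h2 := T w hw v hv
      have h3 := B v hv w hw
      ext u
      simp only [Set.mem_sdiff, mem_neighborSet, Set.mem_singleton_iff]
      grind
    · push Not at hadj
      refine h₃ ⟨hnt, hadj, fun v hv w hw => ?_⟩
      ext u
      exact ⟨F v hv w hw (hadj v hv w hw) u, F w hw v hv (hadj w hw v hv) u⟩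

/-- The graph is in normal form: the type function does not take the value `star` (equivalently,
the set of centers of parts of type `star` is empty). -/
def IsNormalForm : Prop := ∀ P : G.FoliagePartition, G.foliageType P ≠ .star

/-- The foliage graph `Ĝ`: two distinct parts are adjacent if and only if some vertex of the one is
adjacent in `G` to some vertex of the other. -/
def foliageGraph : SimpleGraph G.FoliagePartition where
  Adj P Q := P ≠ Q ∧ ∃ v ∈ G.foliagePart P, ∃ w ∈ G.foliagePart Q, G.Adj v w
  symm := ⟨fun _ _ ⟨hne, v, hv, w, hw, h⟩ => ⟨hne.symm, w, hw, v, hv, h.symm⟩⟩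
  loopless := ⟨fun _ h => h.1 rfl⟩

/-- The diagonal matrix `D_T`, with entry `1` at the parts of type `clique` and `0` elsewhere. -/
def foliageDiagonal : Matrix G.FoliagePartition G.FoliagePartition (ZMod 2) :=
  Matrix.diagonal fun P =>
    match G.foliageType P with
    | .clique => 1
    | _ => 0

/-- The matrix `E = Γ_Ĝ + D_T` over the field with two elements. -/
def foliageMatrix : Matrix G.FoliagePartition G.FoliagePartition (ZMod 2) :=
  G.foliageGraph.adjMatrix (ZMod 2) + G.foliageDiagonal

/-- The set of all parts that meet `A`. -/
def partsMeeting [Fintype V] (A : Set V) : Finset G.FoliagePartition :=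
  {P | (G.foliagePart P ∩ A).Nonempty}

end SimpleGraph

/-! ### Pure states of qubits labelled by a finite set, and their entanglement entropy -/

/-- Vectors of `(ℂ²)^{⊗ V}` by their coefficients in the computational basis, which is indexed by
the bit strings `x : V → Fin 2`. -/
abbrev QubitState (V : Type*) : Type _ := (V → Fin 2) → ℂ

/-- The reduced density matrix `ρ_A = tr_{A'} |ψ⟩⟨ψ|`, where `A'` is the complement of `A`. The
matrix `|ψ⟩⟨ψ|` has the entry `ψ x * conj (ψ y)` in row `x` and column `y`. -/
def reducedDensityMatrix {V : Type*} [Fintype V] (A : Set V) (ψ : QubitState V) :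
    Matrix (A → Fin 2) (A → Fin 2) ℂ :=
  let glue (a : A → Fin 2) (b : (Aᶜ : Set V) → Fin 2) : V → Fin 2 := fun v =>
    if h : v ∈ A then a ⟨v, h⟩ else b ⟨v, h⟩
  Matrix.of fun a a' => ∑ b : (Aᶜ : Set V) → Fin 2,
    Matrix.vecMulVec ψ (star ψ) (glue a b) (glue a' b)

/-- The entropy of entanglement `S_A = -Tr (ρ_A log₂ ρ_A)`. The logarithm of the Hermitian matrix
`ρ_A` is taken by functional calculus, with the usual convention `0 log₂ 0 = 0`; the trace is a
real number. -/
def entanglementEntropy {V : Type*} [Fintype V] (A : Set V) (ψ : QubitState V) : ℝ :=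
  -(Matrix.trace (reducedDensityMatrix A ψ *
      cfc (Real.logb 2) (reducedDensityMatrix A ψ))).re

/-! ### Graph states -/

/-- The state `|+⟩^{⊗ V}`. -/
def plusState (V : Type*) [Fintype V] : QubitState V :=
  fun _ => ∏ _v : V, (1 / (Real.sqrt 2 : ℂ))

/-- The controlled-Z operator on the qubits `v` and `w`, where `e = {v, w}`: it multiplies the
basis vector `|x⟩` by `(-1) ^ (x v * x w)`. -/
def controlledZ {V : Type*} [Fintype V] (e : Sym2 V) : Matrix (V → Fin 2) (V → Fin 2) ℂ :=
  Matrix.diagonal fun x =>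
    Sym2.lift ⟨fun v w => (-1 : ℂ) ^ ((x v : ℕ) * (x w : ℕ)), fun v w => by simp only [mul_comm]⟩ e

theorem controlledZ_pairwise {V : Type*} [Fintype V] (s : Set (Sym2 V)) :
    s.Pairwise (Function.onFun Commute (controlledZ (V := V))) := by
  intro e _ f _ _
  unfold Function.onFun Commute SemiconjBy controlledZ
  rw [Matrix.diagonal_mul_diagonal, Matrix.diagonal_mul_diagonal]
  simp only [mul_comm]

/-- The graph state `|G⟩`: the product of the (commuting) controlled-Z operators over all edges of
`G`, applied to `|+⟩^{⊗ V}`. -/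
def SimpleGraph.graphState {V : Type*} [Fintype V] (G : SimpleGraph V) : QubitState V :=
  (G.edgeFinset.noncommProd controlledZ (controlledZ_pairwise _)).mulVec
    (plusState V)

end

noncomputable section
open scoped Classical

/-! ### Ranks under repetition, and entropy of a multiple of a projection -/

namespace Matrix

/-! For every graph, `S_A` is the rank `r` of the adjacency block `A × A'` over the field with two
elements (`entanglementEntropy_graphState`). Each amplitude is, up to normalization, a sign that
splits into an inner, an outer and a cut factor; the cut factor is a character in the bits `b` on
`A'`. Summing over `b`, orthogonality of characters leaves `ρ_A(a, a') = ± 2^(-|A|)` when `a` and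
`a'` have the same image under the linear map `cutMap`, and `0` otherwise. The fibers of this map
have `2^(|A| - r)` elements, so `ρ_A² = 2^(-r) ρ_A`, and with trace `1` the entropy is `r`.

Without stars, adjacency of distinct vertices depends only on their parts and is read off `E`;
within a part it is the diagonal entry, `1` for cliques (`IsNormalForm.foliageMatrix_apply`). A
vertex of `A` never equals one of `A'`, so the block is `E` on the parts meeting `A` and `A'` with
rows and columns repeated, which preserves the rank. -/

theorem rank_submatrix_of_surjective {m n m₀ n₀ R : Type*} [Fintype n] [Fintype n₀]
    [CommRing R] [StrongRankCondition R] (M : Matrix m n R) {f : m₀ → m} {g : n₀ → n}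
    (hf : f.Surjective) (hg : g.Surjective) : (M.submatrix f g).rank = M.rank := by
  refine le_antisymm (rank_submatrix_le _ _ _) ?_
  -- Sections of `f` and `g` exhibit `M` as a submatrix of its own submatrix.
  have h : M = (M.submatrix f g).submatrix (Function.surjInv hf) (Function.surjInv hg) := by
    ext i j
    simp [Function.surjInv_eq]
  conv_lhs => rw [h]
  exact rank_submatrix_le _ _ _

/-- Since `c⁻¹ • ρ` is idempotent, the spectrum of `ρ` lies in `{0, c}`, where `x * f x` and `f c *
x` agree. The factor `ρ` makes the value `f 0` irrelevant. -/
theorem mul_cfc_of_mul_self_eq_smul {n : Type*} [Fintype n] [DecidableEq n] {ρ : Matrix n n ℂ}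
    (hρ : ρ.IsHermitian) {c : ℝ} (hc : c ≠ 0) (hsq : ρ * ρ = c • ρ) (f : ℝ → ℝ) :
    ρ * cfc f ρ = f c • ρ := by
  have hsa : IsSelfAdjoint ρ := hρ
  have hidem : IsIdempotentElem (c⁻¹ • ρ) := by
    simp only [IsIdempotentElem, Matrix.smul_mul, Matrix.mul_smul, hsq, smul_smul]
    rw [inv_mul_cancel₀ hc, mul_one]
  -- On a finite spectrum every function is continuous, so `cfc` does not take its default value
  -- `0`, even for a logarithm at `0`.
  have hfin : (spectrum ℝ ρ).Finite := by
    rw [show ρ = Units.mk0 c hc • (c⁻¹ • ρ) by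
      rw [Units.smul_mk0, smul_smul, mul_inv_cancel₀ hc, one_smul], spectrum.unit_smul_eq_smul]
    exact (hidem.finite_spectrum ℝ).smul_set
  have hspec : ∀ x ∈ spectrum ℝ ρ, x = 0 ∨ x = c := by
    intro x hx
    rw [show ρ = Units.mk0 c hc • (c⁻¹ • ρ) by
      rw [Units.smul_mk0, smul_smul, mul_inv_cancel₀ hc, one_smul],
      spectrum.unit_smul_eq_smul] at hx
    obtain ⟨y, hy, rfl⟩ := hx
    rcases hidem.spectrum_subset ℝ hy with rfl | rfl
    · simp
    · right; simp
  have hcont : ∀ g : ℝ → ℝ, ContinuousOn g (spectrum ℝ ρ) := fun g => hfin.continuousOn g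
  calc ρ * cfc f ρ = cfc (fun x : ℝ => x) ρ * cfc f ρ := by rw [cfc_id' ℝ ρ]
    _ = cfc (fun x => x * f x) ρ := (cfc_mul _ f ρ (hcont _) (hcont _)).symm
    _ = cfc (f c * ·) ρ := cfc_congr fun x hx => by
        rcases hspec x hx with rfl | rfl <;> simp [mul_comm]
    _ = f c • ρ := cfc_const_mul_id _ ρ

end Matrix

theorem entanglementEntropy_eq_of_mul_self {V : Type*} [Fintype V] (A : Set V) (ψ : QubitState V)
    (r : ℕ) (hherm : (reducedDensityMatrix A ψ).IsHermitian)
    (hsq : reducedDensityMatrix A ψ * reducedDensityMatrix A ψ =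
      ((2 : ℝ) ^ r)⁻¹ • reducedDensityMatrix A ψ)
    (htr : (reducedDensityMatrix A ψ).trace = 1) :
    entanglementEntropy A ψ = r := by
  unfold entanglementEntropy
  rw [Matrix.mul_cfc_of_mul_self_eq_smul hherm (by positivity) hsq, Matrix.trace_smul, htr]
  simp [Real.logb_inv, Real.logb_pow]

/-! ### Amplitudes of a graph state -/

/-- The sign by which the controlled-Z operator on `e` multiplies the basis vector `|x⟩`. -/
def edgeSign {V : Type*} (x : V → Fin 2) (e : Sym2 V) : ℂ :=
  Sym2.lift ⟨fun v w => (-1 : ℂ) ^ ((x v : ℕ) * (x w : ℕ)), fun v w => by simp only [mul_comm]⟩ e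

@[simp] theorem edgeSign_mk {V : Type*} (x : V → Fin 2) (v w : V) :
    edgeSign x s(v, w) = (-1 : ℂ) ^ ((x v : ℕ) * (x w : ℕ)) := rfl

theorem edgeSign_eq_one_or {V : Type*} (x : V → Fin 2) (e : Sym2 V) :
    edgeSign x e = 1 ∨ edgeSign x e = -1 := by
  induction e with
  | h v w => exact neg_one_pow_eq_or ℂ _

theorem edgeSign_congr {V : Type*} {x y : V → Fin 2} {e : Sym2 V} (h : ∀ v ∈ e, x v = y v) :
    edgeSign x e = edgeSign y e := by
  induction e with
  | h v w => simp [h v (by simp), h w (by simp)]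

theorem Finset.prod_eq_one_or_neg_one {ι R : Type*} [CommRing R] (s : Finset ι) (f : ι → R)
    (h : ∀ i, f i = 1 ∨ f i = -1) : ∏ i ∈ s, f i = 1 ∨ ∏ i ∈ s, f i = -1 := by
  induction s using Finset.induction with
  | empty => simp
  | insert i s hi ih =>
    rw [Finset.prod_insert hi]
    rcases h i with h | h <;> rcases ih with ih | ih <;> simp [h, ih]

theorem noncommProd_controlledZ {V : Type*} [Fintype V] (s : Finset (Sym2 V)) :
    s.noncommProd controlledZ (controlledZ_pairwise _) =
      Matrix.diagonal fun x => ∏ e ∈ s, edgeSign x e := by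
  induction s using Finset.induction with
  | empty => simp
  | insert e s he ih =>
    rw [Finset.noncommProd_insert_of_notMem _ _ _ _ he, ih]
    simp only [controlledZ, Matrix.diagonal_mul_diagonal, Finset.prod_insert he]
    rfl

theorem SimpleGraph.graphState_apply {V : Type*} [Fintype V] (G : SimpleGraph V)
    (x : V → Fin 2) :
    G.graphState x = (∏ e ∈ G.edgeFinset, edgeSign x e) * ∏ _v : V, (1 / (Real.sqrt 2 : ℂ)) := by
  rw [graphState, noncommProd_controlledZ, Matrix.mulVec_diagonal]
  rfl

/-- The bit string on `V` that restricts to `a` on `A` and to `b` on the complement of `A`. -/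
def glueBits {V : Type*} {A : Set V} (a : A → Fin 2) (b : (Aᶜ : Set V) → Fin 2) : V → Fin 2 :=
  fun v => if h : v ∈ A then a ⟨v, h⟩ else b ⟨v, h⟩

theorem glueBits_of_mem {V : Type*} {A : Set V} (a : A → Fin 2) (b : (Aᶜ : Set V) → Fin 2)
    {v : V} (h : v ∈ A) : glueBits a b v = a ⟨v, h⟩ := dif_pos h

theorem glueBits_of_notMem {V : Type*} {A : Set V} (a : A → Fin 2) (b : (Aᶜ : Set V) → Fin 2)
    {v : V} (h : v ∉ A) : glueBits a b v = b ⟨v, h⟩ := dif_neg h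

theorem reducedDensityMatrix_apply {V : Type*} [Fintype V] (A : Set V) (ψ : QubitState V)
    (a a' : A → Fin 2) : reducedDensityMatrix A ψ a a' =
      ∑ b : (Aᶜ : Set V) → Fin 2, ψ (glueBits a b) * star (ψ (glueBits a' b)) := rfl

/-! ### Adjacency read off the foliage matrix -/

namespace SimpleGraph

variable {V : Type*} {G : SimpleGraph V}

theorem mem_foliagePart_foliageClass (v : V) : v ∈ G.foliagePart (G.foliageClass v) := rfl

/-- Vertices of a clique or independent part are twins. Only in a star can they differ outside the
part. -/
theorem IsNormalForm.adj_congr_left (hG : G.IsNormalForm) {P : G.FoliagePartition} {v v' u : V}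
    (hv : v ∈ G.foliagePart P) (hv' : v' ∈ G.foliagePart P) (hu : u ∉ G.foliagePart P)
    (h : G.Adj v u) : G.Adj v' u := by
  have ht := G.hasFoliageType_foliageType P
  have hne := hG P
  generalize G.foliageType P = t at ht hne
  cases t with
  | singleton =>
    obtain ⟨x, hx⟩ := ht
    rw [hx] at hv hv'
    rwa [hv', ← hv]
  | star => exact absurd rfl hne
  | clique =>
    have hmem : u ∈ G.neighborSet v \ {v'} := ⟨h, fun he => hu (he ▸ hv')⟩
    rw [ht.2.2 v hv v' hv'] at hmem
    exact hmem.1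
  | indep =>
    have hmem : u ∈ G.neighborSet v := h
    rwa [ht.2.2 v hv v' hv'] at hmem

theorem IsNormalForm.foliageMatrix_apply (hG : G.IsNormalForm) {v w : V} (hvw : v ≠ w) :
    G.foliageMatrix (G.foliageClass v) (G.foliageClass w) = G.adjMatrix (ZMod 2) v w := by
  by_cases hP : G.foliageClass v = G.foliageClass w
  · have hw : w ∈ G.foliagePart (G.foliageClass v) := hP.symm
    have hv := mem_foliagePart_foliageClass (G := G) v
    have ht := G.hasFoliageType_foliageType (G.foliageClass v)
    have hne := hG (G.foliageClass v)
    rw [← hP]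
    simp only [foliageMatrix, foliageDiagonal, Matrix.add_apply, adjMatrix_apply,
      SimpleGraph.irrefl, if_false, Matrix.diagonal_apply_eq, zero_add]
    generalize G.foliageType (G.foliageClass v) = t at ht hne
    cases t with
    | singleton =>
      obtain ⟨x, hx⟩ := ht
      rw [hx] at hv hw
      exact absurd (Eq.trans hv hw.symm) hvw
    | star => exact absurd rfl hne
    | clique => simp [ht.2.1 v hv w hw hvw]
    | indep => simp [ht.2.1 v hv w hw]
  · have hiff : G.foliageGraph.Adj (G.foliageClass v) (G.foliageClass w) ↔ G.Adj v w := by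
      refine ⟨?_, fun h => ⟨hP, v, rfl, w, rfl, h⟩⟩
      rintro ⟨_, v', hv', w', hw', h⟩
      -- The witnessing edge is moved to `v` and `w` one endpoint at a time.
      have h1 : G.Adj v w' := hG.adj_congr_left hv' rfl
        (fun h => hP (Eq.trans (Eq.symm h) hw')) h
      exact (hG.adj_congr_left hw' rfl (fun h => hP h) h1.symm).symm
    simp [foliageMatrix, foliageDiagonal, adjMatrix_apply, Matrix.diagonal_apply_ne _ hP, hiff]

/-! ### Splitting the sign along the cut -/

variable [Fintype V] (G)

/-- The block of the adjacency matrix with rows in `A` and columns outside of `A`. -/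
def cutMatrix (A : Set V) : Matrix A (Aᶜ : Set V) (ZMod 2) :=
  (G.adjMatrix (ZMod 2)).submatrix Subtype.val Subtype.val

/-- The number of neighbors `v ∈ A` of `w` at which `a` has the bit `1`. -/
def cutCount {A : Set V} (a : A → Fin 2) (w : (Aᶜ : Set V)) : ℕ :=
  ∑ v : A, if G.Adj v w then (a v : ℕ) else 0

/-- The sign that the edges between `A` and its complement contribute. -/
def cutSign {A : Set V} (a : A → Fin 2) (b : (Aᶜ : Set V) → Fin 2) : ℂ :=
  ∏ w, (-1 : ℂ) ^ ((b w : ℕ) * G.cutCount a w)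

/-- A crossing edge has exactly one end on each side, so these edges biject with adjacent pairs `(w,
v)`, `w ∉ A`, `v ∈ A`. -/
theorem prod_edgeSign_cut {A : Set V} (a : A → Fin 2) (b : (Aᶜ : Set V) → Fin 2) :
    ∏ e ∈ G.edgeFinset with (∃ v ∈ e, v ∈ A) ∧ ∃ v ∈ e, v ∉ A, edgeSign (glueBits a b) e =
      G.cutSign a b := by
  have h1 : G.cutSign a b =
      ∏ p : (Aᶜ : Set V) × A with G.Adj p.2 p.1, (-1 : ℂ) ^ ((b p.1 : ℕ) * (a p.2 : ℕ)) := by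
    rw [Finset.prod_filter, Fintype.prod_prod_type]
    refine Finset.prod_congr rfl fun w _ => ?_
    rw [cutCount, Finset.mul_sum, ← Finset.prod_pow_eq_pow_sum]
    refine Finset.prod_congr rfl fun v _ => ?_
    split_ifs <;> simp
  rw [h1]
  symm
  refine Finset.prod_bij (fun p _ => s((p.1 : V), (p.2 : V))) ?_ ?_ ?_ ?_
  · rintro ⟨w, v⟩ h
    simp only [Finset.mem_filter, Finset.mem_univ, true_and] at h
    simp only [Finset.mem_filter, mem_edgeFinset, mem_edgeSet]
    exact ⟨h.symm, ⟨v, by simp, v.2⟩, ⟨w, by simp, w.2⟩⟩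
  · rintro ⟨w, v⟩ _ ⟨w', v'⟩ _ h
    have hw := w.2
    have hw' := w'.2
    simp only [Sym2.eq_iff] at h
    rcases h with h | h
    · exact Prod.ext (Subtype.ext h.1) (Subtype.ext h.2)
    · exact absurd (h.1 ▸ v'.2) hw
  · intro e he
    induction e with
    | h v w =>
      simp only [Finset.mem_filter, mem_edgeFinset, mem_edgeSet, Sym2.mem_iff, exists_eq_or_imp,
        exists_eq_left] at he
      obtain ⟨hadj, h1, h2⟩ := he
      by_cases hv : v ∈ A
      · have hw : w ∉ A := by tauto
        exact ⟨(⟨w, hw⟩, ⟨v, hv⟩), by simpa using hadj, Sym2.eq_swap⟩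
      · have hw : w ∈ A := by tauto
        exact ⟨(⟨v, hv⟩, ⟨w, hw⟩), by simpa using hadj.symm, rfl⟩
  · rintro ⟨w, v⟩ _
    simp [glueBits_of_mem a b v.2, glueBits_of_notMem a b w.2]

/-- The sign that the edges inside of `A` contribute. -/
def innerSign {A : Set V} (a : A → Fin 2) : ℂ :=
  ∏ e ∈ G.edgeFinset with ¬ ∃ v ∈ e, v ∉ A, edgeSign (glueBits a 0) e

/-- The sign that the edges outside of `A` contribute. -/
def outerSign {A : Set V} (b : (Aᶜ : Set V) → Fin 2) : ℂ :=
  ∏ e ∈ G.edgeFinset with (¬ ∃ v ∈ e, v ∈ A) ∧ ∃ v ∈ e, v ∉ A, edgeSign (glueBits 0 b) e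

/-- Every edge lies inside `A`, outside `A`, or crosses. The zero padding in `innerSign` and
`outerSign` is never read by their edges. -/
theorem prod_edgeSign_glueBits {A : Set V} (a : A → Fin 2) (b : (Aᶜ : Set V) → Fin 2) :
    ∏ e ∈ G.edgeFinset, edgeSign (glueBits a b) e =
      G.innerSign a * G.outerSign b * G.cutSign a b := by
  rw [← Finset.prod_filter_not_mul_prod_filter _ (fun e : Sym2 V => ∃ v ∈ e, v ∉ A),
    ← Finset.prod_filter_not_mul_prod_filter
      (G.edgeFinset.filter fun e : Sym2 V => ∃ v ∈ e, v ∉ A)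
      (fun e : Sym2 V => ∃ v ∈ e, v ∈ A),
    Finset.filter_filter, Finset.filter_filter, ← prod_edgeSign_cut, mul_assoc, innerSign, outerSign]
  congr 1
  · refine Finset.prod_congr rfl fun e he => edgeSign_congr fun v hv => ?_
    have hvA : v ∈ A := by
      by_contra h
      exact (Finset.mem_filter.1 he).2 ⟨v, hv, h⟩
    rw [glueBits_of_mem _ _ hvA, glueBits_of_mem _ _ hvA]
  · congr 1
    · refine Finset.prod_congr (by simp only [and_comm]) fun e he => edgeSign_congr fun v hv => ?_
      have hvA : v ∉ A := fun h => (Finset.mem_filter.1 he).2.1 ⟨v, hv, h⟩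
      rw [glueBits_of_notMem _ _ hvA, glueBits_of_notMem _ _ hvA]
    · exact Finset.prod_congr (by simp only [and_comm]) fun _ _ => rfl

theorem innerSign_eq_one_or {A : Set V} (a : A → Fin 2) :
    G.innerSign a = 1 ∨ G.innerSign a = -1 :=
  Finset.prod_eq_one_or_neg_one _ _ fun _ => edgeSign_eq_one_or _ _

theorem outerSign_eq_one_or {A : Set V} (b : (Aᶜ : Set V) → Fin 2) :
    G.outerSign b = 1 ∨ G.outerSign b = -1 :=
  Finset.prod_eq_one_or_neg_one _ _ fun _ => edgeSign_eq_one_or _ _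

theorem cutSign_eq_one_or {A : Set V} (a : A → Fin 2) (b : (Aᶜ : Set V) → Fin 2) :
    G.cutSign a b = 1 ∨ G.cutSign a b = -1 :=
  Finset.prod_eq_one_or_neg_one _ _ fun _ => neg_one_pow_eq_or ℂ _

/-! ### The reduced density matrix -/

/-- The parity of the number of neighbors `v ∈ A` of `w` at which `a` has the bit `1`. -/
def cutParity {A : Set V} (a : A → Fin 2) (w : (Aᶜ : Set V)) : ZMod 2 :=
  (G.cutCount a w : ZMod 2)

/-- Orthogonality of characters: the sum factors over `w` into terms `1 + (-1)^n`, with `n` even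
exactly when the parities at `w` agree. -/
theorem sum_cutSign_mul_cutSign {A : Set V} (a a' : A → Fin 2) :
    ∑ b, G.cutSign a b * G.cutSign a' b =
      if G.cutParity a = G.cutParity a' then 2 ^ Fintype.card (Aᶜ : Set V) else 0 := by
  have h1 : ∀ b : (Aᶜ : Set V) → Fin 2, G.cutSign a b * G.cutSign a' b =
      ∏ w, (-1 : ℂ) ^ ((b w : ℕ) * (G.cutCount a w + G.cutCount a' w)) := fun b => by
    simp only [cutSign, ← Finset.prod_mul_distrib, ← pow_add, mul_add]
  have h2 : ∀ w, (∑ t : Fin 2, (-1 : ℂ) ^ ((t : ℕ) * (G.cutCount a w + G.cutCount a' w))) =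
      if G.cutParity a w = G.cutParity a' w then 2 else 0 := by
    intro w
    have hiff : G.cutParity a w = G.cutParity a' w ↔ Even (G.cutCount a w + G.cutCount a' w) := by
      rw [cutParity, cutParity, ← CharTwo.add_eq_zero (R := ZMod 2), ← Nat.cast_add,
        ZMod.natCast_eq_zero_iff_even]
    simp only [hiff, Fin.sum_univ_two]
    split_ifs with h
    · simp [h.neg_one_pow]; norm_num
    · simp [(Nat.not_even_iff_odd.1 h).neg_one_pow]
  simp only [h1]
  rw [← Fintype.prod_sum (fun w (t : Fin 2) =>
    (-1 : ℂ) ^ ((t : ℕ) * (G.cutCount a w + G.cutCount a' w)))]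
  simp only [h2]
  split_ifs with h
  · simp [h]
  · obtain ⟨w, hw⟩ := Function.ne_iff.1 h
    exact Finset.prod_eq_zero (Finset.mem_univ w) (if_neg hw)

theorem reducedDensityMatrix_graphState (A : Set V) (a a' : A → Fin 2) :
    reducedDensityMatrix A G.graphState a a' =
      if G.cutParity a = G.cutParity a' then
        (2 ^ Fintype.card A)⁻¹ * (G.innerSign a * G.innerSign a') else 0 := by
  have hs : ∀ z : ℂ, z = 1 ∨ z = -1 → star z = z := by rintro z (rfl | rfl) <;> simp
  -- The normalization `2^(-|V|)` is split so that its `A'` part cancels the `2^|A'|` of the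
  -- character sum.
  have hc : (∏ _v : V, (1 / (Real.sqrt 2 : ℂ))) * star (∏ _v : V, (1 / (Real.sqrt 2 : ℂ))) =
      (2 ^ Fintype.card A * 2 ^ Fintype.card (Aᶜ : Set V))⁻¹ := by
    have hcard : Fintype.card A + Fintype.card (Aᶜ : Set V) = Fintype.card V := by
      rw [← Fintype.card_sum]
      exact Fintype.card_congr (Equiv.Set.sumCompl A)
    rw [← pow_add, hcard, Finset.prod_const, star_pow, ← mul_pow, Finset.card_univ, ← inv_pow]
    congr 1
    have : (Real.sqrt 2 : ℂ) * Real.sqrt 2 = 2 := by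
      rw [← Complex.ofReal_mul, Real.mul_self_sqrt (by norm_num)]; norm_num
    simp [← mul_inv, this]
  have h1 : ∀ b : (Aᶜ : Set V) → Fin 2,
      G.graphState (glueBits a b) * star (G.graphState (glueBits a' b)) =
        (2 ^ Fintype.card A * 2 ^ Fintype.card (Aᶜ : Set V))⁻¹ *
          (G.innerSign a * G.innerSign a') * (G.cutSign a b * G.cutSign a' b) := by
    intro b
    have hb : G.outerSign b * G.outerSign b = 1 := by
      rcases G.outerSign_eq_one_or b with h | h <;> simp [h]
    rw [graphState_apply, graphState_apply, prod_edgeSign_glueBits, prod_edgeSign_glueBits,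
      star_mul', ← hc, star_mul', star_mul', hs _ (G.innerSign_eq_one_or a'),
      hs _ (G.outerSign_eq_one_or b), hs _ (G.cutSign_eq_one_or a' b)]
    linear_combination (G.innerSign a * G.innerSign a' * G.cutSign a b * G.cutSign a' b *
      ((∏ _v : V, (1 / (Real.sqrt 2 : ℂ))) * star (∏ _v : V, (1 / (Real.sqrt 2 : ℂ))))) * hb
  rw [reducedDensityMatrix_apply, Finset.sum_congr rfl fun b _ => h1 b, ← Finset.mul_sum,
    sum_cutSign_mul_cutSign]
  split_ifs
  · field_simp
  · simp

/-! ### Fibers of the parity map and the entropy -/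

/-- The parity map as a linear map over the field with two elements. -/
def cutMap (A : Set V) : (A → ZMod 2) →ₗ[ZMod 2] ((Aᶜ : Set V) → ZMod 2) :=
  (G.cutMatrix A).transpose.mulVecLin

theorem cutMap_natCast {A : Set V} (a : A → Fin 2) :
    G.cutMap A (fun v => ((a v : ℕ) : ZMod 2)) = G.cutParity a := by
  ext w
  simp [cutMap, cutMatrix, cutParity, cutCount, Matrix.mulVec, dotProduct, adjMatrix_apply, adj_comm]

/-- Rank-nullity: each nonempty fiber of a linear map is a coset of its kernel. -/
theorem two_pow_rank_mul_card_fiber (A : Set V) (a : A → Fin 2) :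
    2 ^ (G.cutMatrix A).rank *
      (Finset.univ.filter fun x : A → Fin 2 => G.cutParity a = G.cutParity x).card =
        2 ^ Fintype.card A := by
  let bits : (A → Fin 2) ≃ (A → ZMod 2) := Equiv.piCongrRight fun _ => (ZMod.finEquiv 2).toEquiv
  have hbits : ∀ x, G.cutMap A (bits x) = G.cutParity x := fun x => by
    rw [← cutMap_natCast]
    congr 1
    ext v
    change ZMod.finEquiv 2 (x v) = _
    generalize x v = t
    fin_cases t <;> rfl
  have h1 : (Finset.univ.filter fun x : A → Fin 2 => G.cutParity a = G.cutParity x).card =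
      Fintype.card (LinearMap.ker (G.cutMap A)) := by
    rw [← Fintype.card_subtype]
    -- Subtracting the bits of `a` carries its fiber onto the kernel.
    refine Fintype.card_congr ((bits.trans (Equiv.subRight (bits a))).subtypeEquiv fun x => ?_)
    simp [hbits, sub_eq_zero, eq_comm]
  have h2 := (G.cutMap A).finrank_range_add_finrank_ker
  have h3 : (G.cutMatrix A).rank = Module.finrank (ZMod 2) (LinearMap.range (G.cutMap A)) := by
    rw [← Matrix.rank_transpose]; rfl
  rw [h1, Module.card_eq_pow_finrank (K := ZMod 2), ZMod.card, h3, ← pow_add, h2,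
    Module.finrank_fintype_fun_eq_card]

theorem entanglementEntropy_graphState (A : Set V) :
    entanglementEntropy A G.graphState = (G.cutMatrix A).rank := by
  have hs : ∀ a : A → Fin 2, G.innerSign a * G.innerSign a = 1 := fun a => by
    rcases G.innerSign_eq_one_or a with h | h <;> simp [h]
  have hstar : ∀ a : A → Fin 2, star (G.innerSign a) = G.innerSign a := fun a => by
    rcases G.innerSign_eq_one_or a with h | h <;> simp [h]
  refine entanglementEntropy_eq_of_mul_self A _ _ ?_ ?_ ?_
  · ext a a'
    rw [Matrix.conjTranspose_apply, reducedDensityMatrix_graphState,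
      reducedDensityMatrix_graphState, apply_ite star]
    simp only [star_mul', hstar, star_inv₀, star_pow, star_ofNat, star_zero, eq_comm,
      mul_comm (G.innerSign a)]
  · ext a a'
    rw [Matrix.mul_apply, Matrix.smul_apply]
    simp only [reducedDensityMatrix_graphState]
    -- As `innerSign x` squares to `1`, a term depends on `x` only through membership in the fiber
    -- of `a`; the sum over `x` just counts that fiber.
    have hterm : ∀ x : A → Fin 2,
        (if G.cutParity a = G.cutParity x then
          (2 ^ Fintype.card A : ℂ)⁻¹ * (G.innerSign a * G.innerSign x) else 0) *
        (if G.cutParity x = G.cutParity a' then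
          (2 ^ Fintype.card A : ℂ)⁻¹ * (G.innerSign x * G.innerSign a') else 0) =
        if G.cutParity a = G.cutParity x then
          (if G.cutParity a = G.cutParity a' then (2 ^ Fintype.card A : ℂ)⁻¹ *
            ((2 ^ Fintype.card A : ℂ)⁻¹ * (G.innerSign a * G.innerSign a')) else 0) else 0 := by
      intro x
      by_cases h : G.cutParity a = G.cutParity x
      · rw [if_pos h, if_pos h, h]
        split_ifs
        · linear_combination ((2 ^ Fintype.card A : ℂ)⁻¹ * (2 ^ Fintype.card A : ℂ)⁻¹ *
            G.innerSign a * G.innerSign a') * hs x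
        · simp
      · rw [if_neg h, if_neg h, zero_mul]
    rw [Finset.sum_congr rfl fun x _ => hterm x, ← Finset.sum_filter, Finset.sum_const]
    have hcard := congrArg (Nat.cast : ℕ → ℂ) (G.two_pow_rank_mul_card_fiber A a)
    push_cast at hcard
    split_ifs
    · rw [nsmul_eq_mul, Complex.real_smul]
      push_cast
      rw [← hcard]
      have h0 : ((Finset.univ.filter fun x : A → Fin 2 =>
          G.cutParity a = G.cutParity x).card : ℂ) ≠ 0 := by
        intro h
        rw [h, mul_zero] at hcard
        exact pow_ne_zero _ two_ne_zero hcard.symm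
      field_simp
    · simp
  · simp only [Matrix.trace, Matrix.diag_apply, reducedDensityMatrix_graphState, hs, if_true,
      mul_one]
    simp

/-! ### Passing from vertices to parts -/

variable {G}

/-- The map that sends a vertex of `A` to its part. -/
def toPartsMeeting (A : Set V) (v : A) : G.partsMeeting A :=
  ⟨G.foliageClass v, by simpa [partsMeeting] using ⟨v.1, rfl, v.2⟩⟩

theorem toPartsMeeting_surjective (A : Set V) :
    (toPartsMeeting (G := G) A).Surjective := by
  rintro ⟨P, hP⟩
  simp only [partsMeeting, Finset.mem_filter, Finset.mem_univ, true_and] at hP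
  obtain ⟨v, hv, hvA⟩ := hP
  exact ⟨⟨v, hvA⟩, Subtype.ext hv⟩

theorem IsNormalForm.rank_cutMatrix (hG : G.IsNormalForm) (A : Set V) :
    (G.cutMatrix A).rank = (G.foliageMatrix.submatrix
      (Subtype.val : G.partsMeeting A → G.FoliagePartition)
      (Subtype.val : G.partsMeeting Aᶜ → G.FoliagePartition)).rank := by
  rw [← Matrix.rank_submatrix_of_surjective _ (toPartsMeeting_surjective A)
    (toPartsMeeting_surjective Aᶜ)]
  congr 1
  ext v w
  -- Rows and columns come from complementary sets, so the adjacency diagonal, where `E` may differ,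
  -- is never met.
  have hvw : (v : V) ≠ w := fun h => w.2 (h ▸ v.2)
  exact (hG.foliageMatrix_apply hvw).symm

end SimpleGraph

end

theorem mainTheorem5 {V : Type*} [Fintype V] (G : SimpleGraph V) (hG : G.IsNormalForm)
    (A : Set V) :
    entanglementEntropy A G.graphState =
      ((G.foliageMatrix.submatrix
        (Subtype.val : G.partsMeeting A → G.FoliagePartition)
        (Subtype.val : G.partsMeeting Aᶜ → G.FoliagePartition)).rank : ℝ) := by
  rw [G.entanglementEntropy_graphState, hG.rank_cutMatrix]
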